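/- For a graph $G=(V,E)$ with node set $V=\{v_0,\dots,v_{N-1}\}$ let $n=\lceil\log_2 N\rceil$ and let $\chi_E:\{0,1\}^n\times\{0,1\}^n\to\{0,1\}$ be the characteristic function of its edge set: for $x=(x_0,\dots,x_{n-1})$ put $|x|=\sum_{i=0}^{n-1}x_i2^i$; then $\chi_E(x,y)=1$ if and only if $|x|,|y|<N$ and $v_{|x|}$ and $v_{|y|}$ are adjacent. Let $\pi$ be the interleaved variable order with decreasing significance, that is, the order $x_{n-1},y_{n-1},x_{n-2},y_{n-2},\dots,x_0,y_0$. A $\pi$-OBDD is a rooted directed acyclic graph with two sinks labeled $0$ and $1$, in which every inner node is labeled by a variable and has one outgoing $0$-edge and one outgoing $1$-edge, and in which along every edge between inner nodes the variables occur in the order $\pi$; it represents $f$ if for every assignment $a$ the path from the root that follows the edges given by $a$ ends in the sink labeled $f(a)$. The $\pi$-OBDD size of $f$ is the minimum number of nodes of a $\pi$-OBDD representing $f$. Given intervals $[l_i,r_i]\subset\mathbb{R}$ with $l_i<r_i$ for $0\le i<N$, their interval graph has one node for each interval, and two distinct nodes are adjacent if and only if their intervals intersect. **Theorem.** The worst-case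 $\pi$-OBDD size of an interval graph on $N$ nodes, with the nodes labeled according to the interval starting points, is $\Omega(N\log N)$. That is, there are a constant $c>0$ and an $N_0\in\mathbb{N}$ such that for every $N\ge N_0$ there are intervals $[l_i,r_i]$, $0\le i<N$, with $l_i<r_i$ and $l_0<l_1<\dots<l_{N-1}$, such that the interval graph in which the node $v_i$ is the interval $[l_i,r_i]$ has a characteristic function $\chi_E$ of $\pi$-OBDD size at least $c\,N\log_2 N$. -/

import Mathlib

/-- A `π`-OBDD on Boolean variables indexed by `ι`. The variable order is given by the bijection
`pos`, where `pos v` is the position at which `v` is tested. The nodes are the inner nodes together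
with the two sinks, so the node type is `Inner ⊕ Bool`, where `Sum.inr c` is the sink labeled `c`.
Every inner node is labeled by a variable and has one outgoing edge for each Boolean value, and the
edges between inner nodes respect the order (so the graph is acyclic). Inner nodes unreachable from
the root are not forbidden; deleting them changes neither the represented function nor the minimum
size. -/
structure OBDD {ι : Type} {m : ℕ} (pos : ι ≃ Fin m) where
  Inner : Type
  [fintypeInner : Fintype Inner]
  root : Inner ⊕ Bool
  label : Inner → ι
  succ : Inner → Bool → Inner ⊕ Bool
  ordered : ∀ (v w : Inner) (b : Bool), succ v b = Sum.inl w → pos (label v) < pos (label w)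

namespace OBDD

/-- `B.Leads a u c`: the path from the node `u` that leaves every node labeled `i` via its `a i`-edge
ends in the sink labeled `c`. -/
inductive Leads {ι : Type} {m : ℕ} {pos : ι ≃ Fin m} (B : OBDD pos) (a : ι → Bool) :
    B.Inner ⊕ Bool → Bool → Prop
  | sink (c : Bool) : Leads B a (Sum.inr c) c
  | step (v : B.Inner) (c : Bool) (h : Leads B a (B.succ v (a (B.label v))) c) :
      Leads B a (Sum.inl v) c

/-- `B` represents `f`: for every assignment `a` the path from the root ends in the sink `f a`. -/
def Represents {ι : Type} {m : ℕ} {pos : ι ≃ Fin m} (B : OBDD pos) (f : (ι → Bool) → Bool) : Prop :=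
  ∀ a : ι → Bool, B.Leads a B.root (f a)

/-- The number of nodes: the inner nodes and the two sinks. -/
def size {ι : Type} {m : ℕ} {pos : ι ≃ Fin m} (B : OBDD pos) : ℕ :=
  @Fintype.card B.Inner B.fintypeInner + 2

end OBDD

/-- The `π`-OBDD size of `f`: the minimum size of a `π`-OBDD representing `f`. -/
noncomputable def obddSize {ι : Type} {m : ℕ} (pos : ι ≃ Fin m) (f : (ι → Bool) → Bool) : ℕ :=
  sInf {s : ℕ | ∃ B : OBDD pos, B.Represents f ∧ B.size = s}

/-- The minimum in `obddSize` is over a nonempty set: a complete decision tree represents `f`. -/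
theorem exists_obdd_represents {ι : Type} {m : ℕ} (pos : ι ≃ Fin m) (f : (ι → Bool) → Bool) :
    ∃ B : OBDD pos, B.Represents f := by
  classical
  have : Fintype ι := Fintype.ofEquiv _ pos.symm
  let node : ℕ → (ι → Bool) → (Fin m × (ι → Bool)) ⊕ Bool := fun i a =>
    if h : i < m then Sum.inl (⟨i, h⟩, a) else Sum.inr (f a)
  let B : OBDD pos :=
    { Inner := Fin m × (ι → Bool)
      root := node 0 (fun _ => false)
      label := fun v => pos.symm v.1
      succ := fun v b => node (v.1 + 1) (Function.update v.2 (pos.symm v.1) b)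
      ordered := by
        intro v w b h
        by_cases hm : (v.1 : ℕ) + 1 < m
        · simp only [node, hm, dif_pos, Sum.inl.injEq] at h
          subst h
          simp [Fin.lt_def]
        · simp [node, hm] at h }
  have key : ∀ (a : ι → Bool) (d i : ℕ) (a' : ι → Bool), i + d = m →
      (∀ j, (pos j : ℕ) < i → a' j = a j) → B.Leads a (node i a') (f a) := by
    intro a d
    induction d with
    | zero =>
      intro i a' hi ha
      have e : a' = a := funext fun j => ha j (by have := (pos j).isLt; omega)
      have hn : node i a' = Sum.inr (f a) := by
        simp [node, e, show ¬ i < m by omega]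
      rw [hn]
      exact OBDD.Leads.sink _
    | succ d ih =>
      intro i a' hi ha
      have him : i < m := by omega
      have hn : node i a' = Sum.inl (⟨i, him⟩, a') := by simp [node, him]
      rw [hn]
      refine OBDD.Leads.step _ _ (ih (i + 1) _ (by omega) ?_)
      intro j hj
      by_cases hji : j = pos.symm ⟨i, him⟩
      · subst hji
        simp [B]
      · have hne : (pos j : ℕ) ≠ i := by
          intro h
          apply hji
          rw [Equiv.eq_symm_apply]
          exact Fin.ext h
        simp only [Function.update_of_ne hji]
        exact ha j (by omega)
  exact ⟨B, fun a => key a m 0 _ (by omega) (by intro j hj; omega)⟩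

/-- The `k`-interleaved variable order for `k` vectors of `n` bits and a permutation `σ` of the bit
positions: the variable `(j, i)`, which is bit `i` of the vector `j`, is tested at position
`k * σ⁻¹ i + j`, so that the order is
`x⁰_{σ 0}, …, x^{k-1}_{σ 0}, …, x⁰_{σ (n-1)}, …, x^{k-1}_{σ (n-1)}`. -/
def interleavedOrder (k : ℕ) {n : ℕ} (σ : Equiv.Perm (Fin n)) : Fin k × Fin n ≃ Fin (n * k) :=
  ((Equiv.prodComm (Fin k) (Fin n)).trans (Equiv.prodCongr σ.symm (Equiv.refl (Fin k)))).trans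
    finProdFinEquiv

/-- The interleaved variable order on two vectors of `n` bits with decreasing significance:
`x_{n-1}, y_{n-1}, …, x_0, y_0`. -/
def decreasingInterleavedOrder (n : ℕ) : Fin 2 × Fin n ≃ Fin (n * 2) :=
  interleavedOrder 2 Fin.revPerm

/-- The value `∑ i, x_i 2^i` of a binary number. -/
def binValue {n : ℕ} (x : Fin n → Bool) : ℕ :=
  ∑ i : Fin n, (if x i then 1 else 0) * 2 ^ (i : ℕ)

open Classical in
/-- The characteristic function of the edge set of a graph with nodes `0, …, N - 1`, on two vectors
of `n = ⌈log₂ N⌉` bits (`x` has index `0` and `y` has index `1`). It is `1` iff both vectors encode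
nodes and these nodes are adjacent. -/
noncomputable def charFun {N : ℕ} (G : SimpleGraph (Fin N)) :
    (Fin 2 × Fin (Nat.clog 2 N) → Bool) → Bool :=
  fun a => decide (∃ v w : Fin N, binValue (fun i => a (0, i)) = v ∧
    binValue (fun i => a (1, i)) = w ∧ G.Adj v w)

/-- The interval graph of the intervals `[l i, r i]`: distinct nodes are adjacent iff their intervals
intersect. -/
def intervalGraph {N : ℕ} (l r : Fin N → ℝ) : SimpleGraph (Fin N) where
  Adj i j := i ≠ j ∧ (Set.Icc (l i) (r i) ∩ Set.Icc (l j) (r j)).Nonempty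
  symm := ⟨fun i j h => ⟨h.1.symm, by rw [Set.inter_comm]; exact h.2⟩⟩
  loopless := ⟨fun _ h => h.1 rfl⟩

/-! In an ordered diagram, prefixes of assignments whose subfunctions differ and depend on the next
variable lead to different nodes with that label (`OBDD.Represents.card_le_size`). So it suffices to
find, for about `log N` variables `x_{b-1}`, order `N` such subfunctions each.

In the hard graph (`hardReach`), with `s` about `m / 4` and `2 ^ (m + 1) < N`, each odd `x < 2 ^ m`
is paired with `y`, its farthest neighbor, and the prefix consists of the bits of `x` and `y` from
`b` on. The even nodes in the block of `x` act as queries: their low `s` bits select a bit of `x` to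
be output, whatever `y` is. They reveal all prefix bits of `x`, and also bit `b - 1`, which gives
dependence. The remaining bits of `x`, below `b ≤ 2 * s`, are stored in the high bits of `y`, and
comparing `y` with the reach of an odd node tells two values of `y` apart. Thus all `2 ^ (m - 1)`
odd nodes count at each of `s` levels. -/

namespace OBDD

/-! ### Lower bounds from subfunctions -/

variable {ι : Type} {m : ℕ} {pos : ι ≃ Fin m} {B : OBDD pos}

theorem Leads.unique {a : ι → Bool} {u : B.Inner ⊕ Bool} {c d : Bool}
    (h : B.Leads a u c) (h' : B.Leads a u d) : c = d := by
  induction h with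
  | sink c => cases h'; rfl
  | step v c _ ih =>
    cases h' with
    | step _ _ h' => exact ih h'

/-- The path of `a` from a node `u` passes through a node `w` that lies at position `p` or later, and
every assignment that agrees with `a` before `p` reaches `w` too. -/
theorem Leads.exists_node {a : ι → Bool} {u : B.Inner ⊕ Bool} {c : Bool} (h : B.Leads a u c)
    (p : Fin m) :
    ∃ w : B.Inner ⊕ Bool, (∀ v, w = Sum.inl v → p ≤ pos (B.label v)) ∧
      ∀ a' : ι → Bool, (∀ i, pos i < p → a' i = a i) → ∀ d, B.Leads a' u d → B.Leads a' w d := by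
  induction h with
  | sink c => exact ⟨Sum.inr c, by simp, fun _ _ _ h => h⟩
  | step v c _ ih =>
    by_cases hp : p ≤ pos (B.label v)
    · refine ⟨Sum.inl v, ?_, fun _ _ _ h => h⟩
      intro w hw
      cases hw
      exact hp
    · obtain ⟨w, hw, hl⟩ := ih
      refine ⟨w, hw, fun a' ha' d hd => hl a' ha' d ?_⟩
      cases hd with
      | step _ _ hd => rwa [ha' _ (not_le.mp hp)] at hd

/-- From a node after position `p` on, the value of the variable at position `p` is irrelevant. -/
theorem Leads.of_eq_off {a a' : ι → Bool} {u : B.Inner ⊕ Bool} {c : Bool} (h : B.Leads a u c)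
    {p : Fin m} (hu : ∀ v, u = Sum.inl v → p < pos (B.label v))
    (ha : ∀ i, pos i ≠ p → a i = a' i) : B.Leads a' u c := by
  induction h with
  | sink c => exact Leads.sink c
  | step v c _ ih =>
    have hv := hu v rfl
    refine Leads.step v c ?_
    rw [← ha _ hv.ne']
    exact ih fun w hw => hv.trans (B.ordered v w _ hw)

/-- If the subfunction of `f` obtained by fixing the variables before `p` as in `a` depends on the
variable at position `p`, then the path of `a` contains a node with that label. -/
theorem Represents.exists_inner {f : (ι → Bool) → Bool} (hB : B.Represents f) (a : ι → Bool)
    (p : Fin m) {a₁ a₂ : ι → Bool} (h₁ : ∀ i, pos i < p → a₁ i = a i)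
    (h₁₂ : ∀ i, pos i ≠ p → a₁ i = a₂ i) (hf : f a₁ ≠ f a₂) :
    ∃ v : B.Inner, pos (B.label v) = p ∧
      ∀ a' : ι → Bool, (∀ i, pos i < p → a' i = a i) → B.Leads a' (Sum.inl v) (f a') := by
  obtain ⟨w, hw, hl⟩ := (hB a).exists_node p
  have l₁ := hl a₁ h₁ _ (hB a₁)
  have l₂ := hl a₂ (fun i hi => (h₁₂ i hi.ne).symm.trans (h₁ i hi)) _ (hB a₂)
  have hnot : ¬ ∀ v, w = Sum.inl v → p < pos (B.label v) := fun h =>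
    hf ((l₁.of_eq_off h h₁₂).unique l₂)
  push Not at hnot
  obtain ⟨v, rfl, hv⟩ := hnot
  exact ⟨v, le_antisymm hv (hw v rfl), fun a' ha' => hl a' ha' _ (hB a')⟩

/-- Lower bound on the size by counting pairwise different subfunctions, each of which depends on the
next variable in the order. -/
theorem Represents.card_le_size {f : (ι → Bool) → Bool} (hB : B.Represents f) {T : Type*} [Fintype T]
    (a : T → ι → Bool) (p : T → Fin m)
    (hdep : ∀ t, ∃ a₁ a₂ : ι → Bool, (∀ i, pos i < p t → a₁ i = a t i) ∧
      (∀ i, pos i ≠ p t → a₁ i = a₂ i) ∧ f a₁ ≠ f a₂)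
    (hdist : ∀ t t', t ≠ t' → p t = p t' → ∃ a₁ a₂ : ι → Bool, (∀ i, pos i < p t → a₁ i = a t i) ∧
      (∀ i, pos i < p t → a₂ i = a t' i) ∧ (∀ i, p t ≤ pos i → a₁ i = a₂ i) ∧ f a₁ ≠ f a₂) :
    Fintype.card T ≤ B.size := by
  have hv : ∀ t, ∃ v : B.Inner, pos (B.label v) = p t ∧
      ∀ a' : ι → Bool, (∀ i, pos i < p t → a' i = a t i) → B.Leads a' (Sum.inl v) (f a') := by
    intro t
    obtain ⟨a₁, a₂, h₁, h₁₂, hf⟩ := hdep t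
    exact hB.exists_inner (a t) (p t) h₁ h₁₂ hf
  choose v hpos hlead using hv
  have hinj : Function.Injective v := by
    intro t t' htt'
    by_contra hne
    have hp : p t = p t' := by rw [← hpos t, ← hpos t', htt']
    obtain ⟨a₁, a₂, h₁, h₂, h₁₂, hf⟩ := hdist t t' hne hp
    have l₁ := hlead t a₁ h₁
    have l₂ := hlead t' a₂ (fun i hi => h₂ i (hp ▸ hi))
    rw [← htt'] at l₂
    apply hf
    -- From position `p t` on both assignments agree, so they follow the same path from the common
    -- node.
    have hup : ∀ (u : B.Inner ⊕ Bool) (c : Bool), B.Leads a₁ u c →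
        (∀ w, u = Sum.inl w → p t ≤ pos (B.label w)) → B.Leads a₂ u c := by
      intro u c h
      induction h with
      | sink c => exact fun _ => Leads.sink c
      | step w c _ ih =>
        intro hu
        have hw := hu w rfl
        refine Leads.step w c ?_
        rw [← h₁₂ _ hw]
        exact ih fun w' hw' => hw.trans (B.ordered w w' _ hw').le
    refine (hup _ _ l₁ ?_).unique l₂
    intro w hw
    cases hw
    exact (hpos t).ge
  exact (@Fintype.card_le_of_injective _ _ _ B.fintypeInner v hinj).trans (Nat.le_add_right _ 2)

end OBDD

/-- Existence of a diagram matters here: `sInf ∅ = 0` in `ℕ`. -/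
theorem le_obddSize {ι : Type} {m : ℕ} {pos : ι ≃ Fin m} {f : (ι → Bool) → Bool} {s : ℕ}
    (h : ∀ B : OBDD pos, B.Represents f → s ≤ B.size) : s ≤ obddSize pos f := by
  obtain ⟨B, hB⟩ := exists_obdd_represents pos f
  refine le_csInf ⟨_, B, hB, rfl⟩ ?_
  rintro _ ⟨B, hB, rfl⟩
  exact h B hB

/-! ### Binary encoding of node pairs -/

theorem decreasingInterleavedOrder_val {n : ℕ} (j : Fin 2) (i : Fin n) :
    (decreasingInterleavedOrder n (j, i) : ℕ) = j + 2 * (n - (i + 1)) := by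
  simp [decreasingInterleavedOrder, interleavedOrder, finProdFinEquiv, Fin.val_rev]

/-- The assignment that encodes the pair `x, y` in binary. -/
def binPair (n x y : ℕ) : Fin 2 × Fin n → Bool :=
  fun v => if v.1 = 0 then x.testBit v.2 else y.testBit v.2

theorem binValue_testBit {n x : ℕ} (hx : x < 2 ^ n) :
    binValue (fun i : Fin n => x.testBit i) = x := by
  unfold binValue
  rw [Fin.sum_univ_eq_sum_range (fun i => (if x.testBit i then 1 else 0) * 2 ^ i) n]
  induction n generalizing x with
  | zero => simp at hx ⊢; omega
  | succ n ih =>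
    rw [Finset.sum_range_succ']
    have h2 : x / 2 < 2 ^ n := by rw [pow_succ] at hx; omega
    have e : ∀ i ∈ Finset.range n, (if x.testBit (i + 1) then 1 else 0) * 2 ^ (i + 1) =
        2 * ((if (x / 2).testBit i then 1 else 0) * 2 ^ i) := by
      intro i _
      rw [Nat.testBit_succ, pow_succ]
      ring
    rw [Finset.sum_congr rfl e, ← Finset.mul_sum, ih h2, Nat.testBit_zero]
    by_cases hp : x % 2 = 1
    · simp [hp]; omega
    · simp [hp]; omega

theorem charFun_binPair {N : ℕ} (G : SimpleGraph (Fin N)) (x y : Fin N) :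
    charFun G (binPair _ x y) = true ↔ G.Adj x y := by
  have hN : N ≤ 2 ^ Nat.clog 2 N := Nat.le_pow_clog (by norm_num) N
  have hx := binValue_testBit (x.2.trans_le hN)
  have hy := binValue_testBit (y.2.trans_le hN)
  classical
  unfold charFun
  rw [decide_eq_true_eq]
  simp only [binPair, if_true, one_ne_zero, if_false]
  rw [hx, hy]
  simp [Fin.val_inj]

/-! ### The hard interval graph -/

/-- The extra `1 / 2` makes every interval nondegenerate without reaching another integer. -/
theorem intervalGraph_adj_nat {N : ℕ} {R : ℕ → ℕ} (hR : ∀ x, x ≤ R x) {x y : Fin N} (hxy : x < y) :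
    (intervalGraph (fun i : Fin N => ((i : ℕ) : ℝ)) (fun i => (R i : ℝ) + 1 / 2)).Adj x y ↔
      (y : ℕ) ≤ R x := by
  have h1 : ((x : ℕ) : ℝ) ≤ (y : ℕ) := by exact_mod_cast hxy.le
  have h2 : ((y : ℕ) : ℝ) ≤ (R y : ℕ) := by exact_mod_cast hR y
  have h3 : ((y : ℕ) : ℝ) ≤ (R x : ℝ) + 1 / 2 ↔ (y : ℕ) ≤ R x := by
    constructor
    · intro h
      by_contra hlt
      have : (R x : ℝ) + 1 ≤ (y : ℕ) := by exact_mod_cast not_le.mp hlt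
      linarith
    · intro h
      have : ((y : ℕ) : ℝ) ≤ (R x : ℝ) := by exact_mod_cast h
      linarith
  rw [← h3]
  simp only [intervalGraph, hxy.ne, ne_eq, not_false_eq_true, true_and, Set.Icc_inter_Icc,
    Set.nonempty_Icc, sup_le_iff, le_inf_iff]
  constructor
  · exact fun h => h.1.2
  · exact fun h => ⟨⟨by linarith, h⟩, ⟨by linarith, by linarith⟩⟩

/-- The last node that the interval of `x < 2 ^ m` reaches in the hard interval graph, where values
below `x` mean that it meets no later interval. Every odd `x < 2 ^ m` ends at its own multiple of `2 ^ (m - 2 * s)` given by its `2 * s` lowest bits, and every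
even one reaches all or none of the nodes from `2 ^ m` to `2 ^ (m + 1)`, which spells out the bits of
`x` from position `s` on. -/
def hardReach (m s x : ℕ) : ℕ :=
  if x % 2 = 1 then 2 ^ m + x % 2 ^ (2 * s) * 2 ^ (m - 2 * s)
  else if x.testBit (x % 2 ^ s / 2 + s) then 2 ^ (m + 1) else 0

/-- The starting point of the block of length `2 ^ b` that contains `x`, plus `u`. -/
def blockAt (b x u : ℕ) : ℕ := x / 2 ^ b * 2 ^ b + u

theorem testBit_blockAt {b x u i : ℕ} (hu : u < 2 ^ b) :
    (blockAt b x u).testBit i = if i < b then u.testBit i else x.testBit i := by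
  rw [blockAt, mul_comm, Nat.testBit_two_pow_mul_add _ hu, Nat.testBit_div_two_pow]
  split_ifs with h
  · rfl
  · congr 1; omega

theorem blockAt_lt {b m x u : ℕ} (hu : u < 2 ^ b) (hbm : b ≤ m) (hx : x < 2 ^ m) :
    blockAt b x u < 2 ^ m := by
  apply Nat.lt_pow_two_of_testBit
  intro i hi
  rw [testBit_blockAt hu, if_neg (by omega)]
  exact Nat.testBit_lt_two_pow (hx.trans_le (Nat.pow_le_pow_right (by norm_num) hi))

/-- Two pairs in the same blocks of length `2 ^ b` agree on all variables tested before `x_{b-1}`. -/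
theorem binPair_eq_of_pos_lt {n b x y x' y' : ℕ} (hbn : b ≤ n)
    (hx : ∀ i, b ≤ i → x.testBit i = x'.testBit i) (hy : ∀ i, b ≤ i → y.testBit i = y'.testBit i)
    (v : Fin 2 × Fin n) (hv : (decreasingInterleavedOrder n v : ℕ) < 2 * (n - b)) :
    binPair n x y v = binPair n x' y' v := by
  obtain ⟨j, i⟩ := v
  rw [decreasingInterleavedOrder_val] at hv
  have := i.2
  have hi : b ≤ i := by omega
  simp [binPair, hx _ hi, hy _ hi]

/-- Two pairs with the same `b` lowest bits agree on all variables from `x_{b-1}` on. -/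
theorem binPair_eq_of_le_pos {n b x y x' y' : ℕ} (hbn : b ≤ n)
    (hx : ∀ i, i < b → x.testBit i = x'.testBit i) (hy : ∀ i, i < b → y.testBit i = y'.testBit i)
    (v : Fin 2 × Fin n) (hv : 2 * (n - b) ≤ (decreasingInterleavedOrder n v : ℕ)) :
    binPair n x y v = binPair n x' y' v := by
  obtain ⟨j, i⟩ := v
  rw [decreasingInterleavedOrder_val] at hv
  have := i.2
  have := j.2
  have hi : (i : ℕ) < b := by omega
  simp [binPair, hx _ hi, hy _ hi]

/-- The query mechanism: since `s ≤ b`, the block starts at a multiple of `2 ^ s`, so the offset `2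
* u` alone determines which bit is read. -/
theorem hardReach_even {m s b x u y : ℕ} (hs : 0 < s) (hsb : s ≤ b) (hu : 2 * u < 2 ^ s)
    (hy : 2 ^ m ≤ y) (hy' : y < 2 ^ (m + 1)) :
    y ≤ hardReach m s (blockAt b x (2 * u)) ↔
      (blockAt b x (2 * u)).testBit (u + s) = true := by
  have hdvd : 2 ^ s ∣ x / 2 ^ b * 2 ^ b := (pow_dvd_pow 2 hsb).mul_left _
  have hm : blockAt b x (2 * u) % 2 ^ s = 2 * u := by
    rw [blockAt, Nat.add_mod, Nat.mod_eq_zero_of_dvd hdvd, zero_add, Nat.mod_mod,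
      Nat.mod_eq_of_lt hu]
  have h2 : blockAt b x (2 * u) % 2 = 0 := by
    have : 2 ∣ x / 2 ^ b * 2 ^ b := (dvd_pow_self 2 (by omega : b ≠ 0)).mul_left _
    rw [blockAt]; omega
  have e : 2 * u / 2 + s = u + s := by omega
  have := Nat.two_pow_pos m
  rw [hardReach, if_neg (by omega), hm, e]
  split_ifs with h
  · simp only [h, hy'.le]
  · exact iff_of_false (by omega) h

theorem hardReach_odd {m s x : ℕ} (hx : x % 2 = 1) :
    hardReach m s x = 2 ^ m + x % 2 ^ (2 * s) * 2 ^ (m - 2 * s) := if_pos hx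

/-! ### Counting subfunctions of the hard graph -/

/-- At each of the `s` levels where blocks have length `2 ^ b`, `s < b ≤ 2 * s`, the `2 ^ (m - 1)` odd
nodes `x < 2 ^ m`, each paired with its farthest neighbor, give different subfunctions. -/
theorem le_size_of_represents_hard {n m s : ℕ} (hm : m + 2 ≤ n) (hs1 : 0 < s) (hs : 2 * (2 * s) ≤ m)
    (hms : 2 * m < 2 ^ s) {f : (Fin 2 × Fin n → Bool) → Bool}
    (hf : ∀ x y, x < 2 ^ m → 2 ^ m ≤ y → y < 2 ^ (m + 1) →
      (f (binPair n x y) = true ↔ y ≤ hardReach m s x))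
    (B : OBDD (decreasingInterleavedOrder n)) (hB : B.Represents f) :
    s * 2 ^ (m - 1) ≤ B.size := by
  let lev : Fin s → ℕ := fun t => s + t + 1
  let row : Fin (2 ^ (m - 1)) → ℕ := fun w => 2 * w + 1
  have row_odd : ∀ w, row w % 2 = 1 := fun w => by simp only [row]; omega
  have row_lt : ∀ w, row w < 2 ^ m := fun w => by
    have := w.2
    have e : 2 ^ m = 2 * 2 ^ (m - 1) := by rw [← pow_succ']; congr 1; omega
    simp only [row]; omega
  have reach_ge : ∀ w, 2 ^ m ≤ hardReach m s (row w) := fun w => by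
    rw [hardReach_odd (row_odd w)]; omega
  have reach_lt : ∀ w, hardReach m s (row w) < 2 ^ (m + 1) := fun w => by
    rw [hardReach_odd (row_odd w)]
    have e : 2 ^ m = 2 ^ (2 * s) * 2 ^ (m - 2 * s) := by rw [← pow_add]; congr 1; omega
    have h := Nat.mul_lt_mul_of_pos_right (Nat.mod_lt (row w) (Nat.two_pow_pos (2 * s)))
      (Nat.two_pow_pos (m - 2 * s))
    rw [pow_succ]; omega
  -- The reach is a multiple of `2 ^ (m - 2 * s)`, and `2 * s ≤ m - 2 * s`.
  have reach_bit : ∀ w i, i < 2 * s → (hardReach m s (row w)).testBit i = false := fun w i hi => by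
    have e : hardReach m s (row w) =
        2 ^ (m - 2 * s) * (2 ^ (2 * s) + row w % 2 ^ (2 * s)) := by
      rw [hardReach_odd (row_odd w), mul_add, ← pow_add, mul_comm (2 ^ (m - 2 * s)) (_ % _)]
      congr 2; omega
    rw [e, Nat.testBit_two_pow_mul]
    simp; omega
  have key := hB.card_le_size (T := Fin s × Fin (2 ^ (m - 1)))
    (fun t => binPair n (row t.2) (hardReach m s (row t.2)))
    -- This is the position of bit `lev t - 1 = s + t` of `x`.
    (fun t => ⟨2 * (n - lev t.1), by have := t.1.2; simp only [lev]; omega⟩) ?_ ?_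
  · simpa using key
  · rintro ⟨t, w⟩
    have ht := t.2
    have hu : 2 * (t : ℕ) < 2 ^ s := by omega
    have hu' : 2 * (t : ℕ) < 2 ^ (s + t) := hu.trans_le (Nat.pow_le_pow_right (by norm_num) (by omega))
    have hpw : 2 ^ (s + t) < 2 ^ lev t := Nat.pow_lt_pow_right (by norm_num) (by simp [lev])
    -- The low bits `2 * t` query bit `s + t`, which is taken from `c`; the bits above are those of
    -- the row.
    let z : ℕ → ℕ := fun c => blockAt (s + t) (blockAt (lev t) (row w) c) (2 * t)
    have z_bit : ∀ c i, c < 2 ^ lev t → (z c).testBit i =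
        if i < s + t then (2 * (t : ℕ)).testBit i
        else if i < lev t then c.testBit i else (row w).testBit i := fun c i hc => by
      simp only [z]
      rw [testBit_blockAt hu', testBit_blockAt hc]
    have z_lt : ∀ c, c < 2 ^ lev t → z c < 2 ^ m := fun c hc =>
      blockAt_lt hu' (by omega) (blockAt_lt hc (by simp only [lev]; omega) (row_lt w))
    have z_f : ∀ c, c < 2 ^ lev t →
        (f (binPair n (z c) (hardReach m s (row w))) = true ↔ c.testBit (s + t) = true) :=
      fun c hc => by
        rw [hf _ _ (z_lt c hc) (reach_ge w) (reach_lt w),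
          hardReach_even hs1 (by omega) hu (reach_ge w) (reach_lt w)]
        change (z c).testBit _ = true ↔ _
        rw [z_bit c _ hc, if_neg (by omega), if_pos (by simp only [lev]; omega), add_comm]
    have h0 : 0 < 2 ^ lev t := Nat.two_pow_pos _
    refine ⟨binPair n (z 0) (hardReach m s (row w)),
      binPair n (z (2 ^ (s + t))) (hardReach m s (row w)), ?_, ?_, ?_⟩
    · intro v hv
      refine binPair_eq_of_pos_lt (b := lev t) (by simp only [lev]; omega) ?_ (fun _ _ => rfl) v hv
      intro i hi
      rw [z_bit 0 i h0, if_neg (by simp only [lev] at hi; omega), if_neg (by omega)]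
    · rintro ⟨j, i⟩ hv
      rw [ne_eq, Fin.ext_iff, decreasingInterleavedOrder_val] at hv
      simp only [binPair]
      split_ifs with hj
      · have hi : (i : ℕ) ≠ s + t := by
          rintro hi
          apply hv
          simp [hj, hi, lev]
        rw [z_bit _ _ h0, z_bit _ _ hpw, Nat.zero_testBit, Nat.testBit_two_pow_of_ne hi.symm]
      · rfl
    · intro h
      have h1 := z_f 0 h0
      rw [h, z_f _ hpw] at h1
      simp at h1
  · rintro ⟨t, w⟩ ⟨t', w'⟩ hne hp
    have ht := t.2
    have ht' := t'.2
    simp only [lev, Fin.mk.injEq] at hp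
    obtain rfl : t = t' := Fin.ext (by omega)
    have hlev : lev t ≤ 2 * s := by simp only [lev]; omega
    have hslev : s ≤ lev t := by simp only [lev]; omega
    -- If the prefixes of `x` agree, the rows differ below `2 * s`, so their reaches differ;
    -- otherwise a query separates them.
    by_cases hbit : ∀ i, lev t ≤ i → (row w).testBit i = (row w').testBit i
    · have hww : hardReach m s (row w) ≠ hardReach m s (row w') := by
        intro h
        rw [hardReach_odd (row_odd w), hardReach_odd (row_odd w')] at h
        have hmod : row w % 2 ^ (2 * s) = row w' % 2 ^ (2 * s) :=
          Nat.eq_of_mul_eq_mul_right (Nat.two_pow_pos (m - 2 * s)) (Nat.add_left_cancel h)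
        have hrow : row w = row w' := by
          apply Nat.eq_of_testBit_eq
          intro i
          by_cases hi : i < 2 * s
          · have := congrArg (fun x => x.testBit i) hmod
            simpa [Nat.testBit_mod_two_pow, hi] using this
          · exact hbit i (by omega)
        apply hne
        have : w = w' := Fin.ext (by simp only [row] at hrow; omega)
        rw [this]
      have hfr : ∀ u v, (f (binPair n (row u) (hardReach m s (row v))) = true ↔
          hardReach m s (row v) ≤ hardReach m s (row u)) := fun u v =>
        hf _ _ (row_lt u) (reach_ge v) (reach_lt v)
      have hlow : ∀ i, i < lev t →
          (hardReach m s (row w)).testBit i = (hardReach m s (row w')).testBit i := fun i hi => by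
        rw [reach_bit w i (by omega), reach_bit w' i (by omega)]
      -- Take the row with the shorter reach: it meets its own endpoint but not the other one.
      obtain ⟨u, hu, hu', hlt⟩ : ∃ u, (∀ i, lev t ≤ i → (row u).testBit i = (row w).testBit i) ∧
          (∀ i, lev t ≤ i → (row u).testBit i = (row w').testBit i) ∧
          ¬ (hardReach m s (row w) ≤ hardReach m s (row u) ↔
            hardReach m s (row w') ≤ hardReach m s (row u)) := by
        rcases lt_or_gt_of_ne hww with h | h
        · exact ⟨w, fun _ _ => rfl, hbit, by omega⟩
        · exact ⟨w', fun i hi => (hbit i hi).symm, fun _ _ => rfl, by omega⟩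
      refine ⟨binPair n (row u) (hardReach m s (row w)),
        binPair n (row u) (hardReach m s (row w')), ?_, ?_, ?_, ?_⟩
      · exact fun v hv => binPair_eq_of_pos_lt (by omega) hu (fun _ _ => rfl) v hv
      · exact fun v hv => binPair_eq_of_pos_lt (by omega) hu' (fun _ _ => rfl) v hv
      · exact fun v hv => binPair_eq_of_le_pos (by omega) (fun _ _ => rfl) hlow v hv
      · intro h
        apply hlt
        rw [← hfr, ← hfr, h]
    · push Not at hbit
      obtain ⟨i, hi, hbit⟩ := hbit
      have him : i < m := by
        by_contra him
        have hle : 2 ^ m ≤ 2 ^ i := Nat.pow_le_pow_right (by norm_num) (by omega)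
        apply hbit
        rw [Nat.testBit_lt_two_pow ((row_lt w).trans_le hle),
          Nat.testBit_lt_two_pow ((row_lt w').trans_le hle)]
      -- The offset `2 * (i - s)` queries bit `i`; `2 * m < 2 ^ s` lets it fit into `s` bits.
      have hu : 2 * (i - s) < 2 ^ s := by omega
      have hu' : 2 * (i - s) < 2 ^ lev t :=
        hu.trans_le (Nat.pow_le_pow_right (by norm_num) hslev)
      have hfb : ∀ v, (f (binPair n (blockAt (lev t) (row v) (2 * (i - s)))
          (hardReach m s (row v))) = true ↔ (row v).testBit i = true) := fun v => by
        rw [hf _ _ (blockAt_lt hu' (by omega) (row_lt v)) (reach_ge v) (reach_lt v),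
          hardReach_even hs1 hslev hu (reach_ge v) (reach_lt v), testBit_blockAt hu',
          if_neg (by omega), Nat.sub_add_cancel (by omega)]
      have hhigh : ∀ v j, lev t ≤ j →
          (blockAt (lev t) (row v) (2 * (i - s))).testBit j = (row v).testBit j := fun v j hj => by
        rw [testBit_blockAt hu', if_neg (by omega)]
      refine ⟨_, _, fun v hv => binPair_eq_of_pos_lt (b := lev t) (by omega) (hhigh w) (fun _ _ => rfl) v hv,
        fun v hv => binPair_eq_of_pos_lt (b := lev t) (by omega) (hhigh w') (fun _ _ => rfl) v hv,
        fun v hv => binPair_eq_of_le_pos (b := lev t) (by omega) ?_ ?_ v hv, ?_⟩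
      · intro j hj
        rw [testBit_blockAt hu', testBit_blockAt hu', if_pos hj, if_pos hj]
      · intro j hj
        rw [reach_bit w j (by omega), reach_bit w' j (by omega)]
      · intro h
        have h1 := hfb w
        rw [h, hfb w'] at h1
        exact hbit (Bool.eq_iff_iff.mpr h1).symm

/-! ### The asymptotic bound -/

theorem mainTheorem3 :
    ∃ c : ℝ, 0 < c ∧ ∃ N₀ : ℕ, ∀ N : ℕ, N₀ ≤ N →
      ∃ l r : Fin N → ℝ, (∀ i, l i < r i) ∧ StrictMono l ∧
        c * ((N : ℝ) * Real.logb 2 (N : ℝ)) ≤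
          (obddSize (decreasingInterleavedOrder (Nat.clog 2 N)) (charFun (intervalGraph l r)) : ℝ) := by
  -- `64 = 8 * 8`, from `N ≤ 8 * 2 ^ (m - 1)` and `log N ≤ m + 2 ≤ 8 * s`; `2 ^ 40` gives `s ≥ 9`,
  -- enough for `2 * m < 2 ^ s`.
  refine ⟨1 / 64, by norm_num, 2 ^ 40, fun N hN => ?_⟩
  obtain ⟨n, hn⟩ : ∃ n, n = Nat.clog 2 N := ⟨_, rfl⟩
  have hn40 : 40 ≤ n := by
    rw [hn, ← Nat.clog_pow 2 40 (by norm_num)]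
    exact Nat.clog_mono_right 2 hN
  have hNle : N ≤ 2 ^ n := hn ▸ Nat.le_pow_clog (by norm_num) N
  have hNgt : 2 ^ (n - 1) < N := by
    rw [hn]
    exact Nat.pow_pred_clog_lt_self (by norm_num) (by omega)
  obtain ⟨m, rfl⟩ : ∃ m, n = m + 2 := ⟨n - 2, by omega⟩
  set s := m / 4 with hs
  have hs9 : 9 ≤ s := by omega
  have hpow : ∀ k : ℕ, 9 ≤ k → 8 * k + 6 < 2 ^ k := by
    intro k hk
    induction k, hk using Nat.le_induction with
    | base => norm_num
    | succ k hk ih => rw [pow_succ]; omega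
  have hms : 2 * m < 2 ^ s := by
    have := hpow s hs9
    omega
  -- The maximum keeps intervals nonempty; it is harmless because only pairs `x < 2 ^ m ≤ y` are
  -- examined.
  let R : ℕ → ℕ := fun x => max x (hardReach m s x)
  have hR : ∀ x, x ≤ R x := fun x => le_max_left _ _
  refine ⟨fun i => ((i : ℕ) : ℝ), fun i => (R i : ℝ) + 1 / 2, ?_, ?_, ?_⟩
  · intro i
    have : ((i : ℕ) : ℝ) ≤ (R i : ℝ) := by exact_mod_cast hR i
    linarith
  · intro i j hij
    exact Nat.cast_lt.mpr hij
  · have hsize : s * 2 ^ (m - 1) ≤ obddSize (decreasingInterleavedOrder (Nat.clog 2 N))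
        (charFun (intervalGraph (fun i : Fin N => ((i : ℕ) : ℝ)) (fun i => (R i : ℝ) + 1 / 2))) := by
      refine le_obddSize fun B hB => le_size_of_represents_hard (by omega) (by omega) (by omega) hms ?_ B hB
      intro x y hx hy hy'
      have hyN : y < N := hy'.trans (by simpa using hNgt)
      have hxy : x < y := by omega
      rw [charFun_binPair _ ⟨x, hxy.trans hyN⟩ ⟨y, hyN⟩, intervalGraph_adj_nat hR (by simpa using hxy)]
      simp only [R, le_max_iff]
      omega
    have hlog0 : 0 ≤ Real.logb 2 N :=
      Real.logb_nonneg (by norm_num) (by exact_mod_cast (Nat.one_le_two_pow.trans hN))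
    have hlog : Real.logb 2 N ≤ m + 2 := by
      rw [Real.logb_le_iff_le_rpow (by norm_num) (by positivity)]
      exact_mod_cast hNle
    have hN' : (N : ℝ) ≤ 4 * 2 ^ m := by
      have : (N : ℝ) ≤ 2 ^ (m + 2) := by exact_mod_cast hNle
      rw [pow_add] at this
      linarith
    have hs' : ((m : ℝ) + 2) / 8 ≤ s := by
      have : m + 2 ≤ 8 * s := by omega
      have : ((m : ℝ) + 2) ≤ 8 * s := by exact_mod_cast this
      linarith
    have e : (2 : ℝ) ^ m = 2 * 2 ^ (m - 1) := by rw [← pow_succ']; congr 1; omega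
    calc 1 / 64 * ((N : ℝ) * Real.logb 2 N) ≤ 1 / 64 * ((4 * 2 ^ m) * (m + 2)) := by gcongr
      _ = ((m : ℝ) + 2) / 8 * 2 ^ (m - 1) := by rw [e]; ring
      _ ≤ s * 2 ^ (m - 1) := by gcongr
      _ ≤ _ := by exact_mod_cast hsize
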